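/- Let $\mathcal A$ be a unital $C^*$-algebra, let $U\neq\{0\}$ be a (left) Hilbert $\mathcal A$-module with $\mathcal A$-valued inner product $\langle\cdot,\cdot\rangle$, linear in the first variable, and let $(\Omega,\mu)$ be a measure space. All integrals of $\mathcal A$-valued functions are Bochner integrals and their existence is part of the conditions below. A map $F:\Omega\to U$ is a *Bessel mapping* if for every $f\in U$ the function $\omega\mapsto\langle f,F(\omega)\rangle$ is measurable, and there is $B>0$ with $\int_\Omega\langle f,F(\omega)\rangle\langle F(\omega),f\rangle\,d\mu(\omega)\le B\langle f,f\rangle$ for all $f\in U$. It is a *continuous frame* if moreover there is $C>0$ with $C\langle f,f\rangle\le\int_\Omega\langle f,F(\omega)\rangle\langle F(\omega),f\rangle\,d\mu(\omega)$ for all $f\in U$. A *dual* of $F$ is a Bessel mapping $G:\Omega\to U$ with $\langle f,g\rangle=\int_\Omega\langle f,G(\omega)\rangle\langle F(\omega),g\rangle\,d\mu(\omega)$ for all $f,g\in U$. A *Riesz-type frame* is a continuous frame that has exactly one dual, where $G_1,G_2$ are identified if for every $f\in U$ one has $\langle f,G_1(\omega)\rangle=\langle f,G_2(\omega)\rangle$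 for almost every $\omega$. A continuous frame $F$ is *exact* if for every measurable $\Omega_1\subseteq\Omega$ with $0<\mu(\Omega_1)<\infty$ the restriction $F|_{\Omega\setminus\Omega_1}$ is not a continuous frame for $U$. Let $F:\Omega\to U$ be a continuous frame whose synthesis operator $T_F:L^2(\Omega,\mathcal A)\to U$, weakly defined by $$\langle T_F\varphi,f\rangle=\int_\Omega\varphi(\omega)\langle F(\omega),f\rangle\,d\mu(\omega)\qquad(f\in U),$$ is well defined, i.e. for each measurable $\varphi:\Omega\to\mathcal A$ for which $\int_\Omega\varphi(\omega)\varphi(\omega)^*\,d\mu(\omega)$ exists there is such a vector $T_F\varphi\in U$. If $F$ is a Riesz-type frame, then $F$ is an exact continuous frame. -/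

import Mathlib

/-!
Continuous frames in Hilbert C⋆-modules.

Mathlib's `CStarModule A U` is a left `A`-module with an `A`-valued inner product that is linear
in its second variable, so the inner product `⟨f, g⟩`, linear in `f`, is written `inner A g f`.
Integrals are Bochner integrals, and measurability of a function into the Banach space `A` is
Bochner (almost everywhere strong) measurability.
-/

open MeasureTheory

section ContinuousFrames

variable (A : Type*) [CStarAlgebra A] [PartialOrder A] [StarOrderedRing A]
  {U : Type*} [NormedAddCommGroup U] [NormedSpace ℂ U] [Module A U] [CStarModule A U]
  {Ω : Type*} [MeasurableSpace Ω]

/-- For every `f`, the function `ω ↦ ⟨f, F ω⟩` is measurable. -/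
def WeaklyMeasurable (μ : Measure Ω) (F : Ω → U) : Prop :=
  ∀ f : U, AEStronglyMeasurable (fun ω => inner A (F ω) f) μ

/-- Bessel mapping: weakly measurable, with `∫ ⟨f, F ω⟩ ⟨F ω, f⟩ dμ ≤ B ⟨f, f⟩` for all `f`. -/
structure IsBesselMapping (μ : Measure Ω) (F : Ω → U) : Prop where
  weaklyMeasurable : WeaklyMeasurable A μ F
  integrable : ∀ f : U, Integrable (fun ω => inner A (F ω) f * inner A f (F ω)) μ
  upper : ∃ B : ℝ, 0 < B ∧ ∀ f : U,
    ∫ ω, inner A (F ω) f * inner A f (F ω) ∂μ ≤ B • inner A f f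

/-- Continuous frame: a Bessel mapping that also has a lower frame bound. -/
structure IsContinuousFrame (μ : Measure Ω) (F : Ω → U) : Prop
    extends IsBesselMapping A μ F where
  lower : ∃ C : ℝ, 0 < C ∧ ∀ f : U,
    C • inner A f f ≤ ∫ ω, inner A (F ω) f * inner A f (F ω) ∂μ

/-- A continuous frame that is no longer a continuous frame on `Ω \ Ω₁`, for any measurable `Ω₁`
of positive finite measure. -/
def IsExactContinuousFrame (μ : Measure Ω) (F : Ω → U) : Prop :=
  IsContinuousFrame A μ F ∧
    ∀ Ω₁ : Set Ω, MeasurableSet Ω₁ → 0 < μ Ω₁ → μ Ω₁ < ⊤ →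
      ¬ IsContinuousFrame A (μ.restrict Ω₁ᶜ) F

/-- Membership in `L²(Ω, A)`: `φ` is measurable and `∫ φ φ⋆ dμ` exists. -/
def MemLTwo (μ : Measure Ω) (φ : Ω → A) : Prop :=
  AEStronglyMeasurable φ μ ∧ Integrable (fun ω => φ ω * star (φ ω)) μ

/-- The synthesis operator `T : L²(Ω, A) → U`, weakly defined by
`⟨T φ, f⟩ = ∫ φ(ω) ⟨F ω, f⟩ dμ` for all `f`, is well defined, that is, the vector `T φ` exists
in `U` for each `φ` (it is then unique). -/
def HasSynthesisOperator (μ : Measure Ω) (F : Ω → U) : Prop :=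
  ∀ φ : Ω → A, MemLTwo A μ φ →
    ∃ u : U, ∀ f : U, inner A f u = ∫ ω, φ ω * inner A f (F ω) ∂μ

/-- `G` is a dual of `F`: a Bessel mapping with `⟨f, g⟩ = ∫ ⟨f, G ω⟩ ⟨F ω, g⟩ dμ` for all
`f, g`. For Bessel mappings `F` and `G` the integrand is always integrable. -/
def IsDualOf (μ : Measure Ω) (G F : Ω → U) : Prop :=
  IsBesselMapping A μ G ∧
    ∀ f g : U, inner A g f = ∫ ω, inner A (G ω) f * inner A g (F ω) ∂μ

/-- Weakly measurable mappings are identified when, for every `f`, the functions `⟨f, G₁ ω⟩` and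
`⟨f, G₂ ω⟩` agree almost everywhere. -/
def WeaklyAEEq (μ : Measure Ω) (G₁ G₂ : Ω → U) : Prop :=
  ∀ f : U, ∀ᵐ ω ∂μ, inner A (G₁ ω) f = inner A (G₂ ω) f

/-- Riesz-type frame: a continuous frame with exactly one dual (up to weak equality almost
everywhere). -/
def IsRieszTypeFrame (μ : Measure Ω) (F : Ω → U) : Prop :=
  IsContinuousFrame A μ F ∧ (∃ G : Ω → U, IsDualOf A μ G F) ∧
    ∀ G₁ G₂ : Ω → U, IsDualOf A μ G₁ F → IsDualOf A μ G₂ F → WeaklyAEEq A μ G₁ G₂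

end ContinuousFrames

/-! If `F` stayed a frame off a set `s` of positive finite measure, it would have too many duals.
Extend the canonical dual off `s` by zero: this is a dual of `F`, so uniqueness equates it with the
canonical dual `S⁻¹ F`. Hence `F` vanishes weakly on `s`, and extending instead by a nonzero
constant `u` also gives a dual, contradicting uniqueness. Canonical duals need `S` invertible, which
follows from a Neumann series. -/

theorem cstarModule_ext_inner {A : Type*} [CStarAlgebra A] [PartialOrder A]
    {U : Type*} [NormedAddCommGroup U] [NormedSpace ℂ U] [Module A U] [CStarModule A U]
    {u v : U} (h : ∀ g : U, inner A g u = inner A g v) : u = v := by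
  rw [← sub_eq_zero, ← CStarModule.inner_self (A := A), CStarModule.inner_sub_right, h, sub_self]

theorem integral_star_cstarAlgebra {A : Type*} [CStarAlgebra A] {Ω : Type*} [MeasurableSpace Ω]
    {μ : Measure Ω} (φ : Ω → A) : ∫ ω, star (φ ω) ∂μ = star (∫ ω, φ ω ∂μ) :=
  (starL' ℝ : A ≃L[ℝ] A).integral_comp_comm φ

section SymmetricMaps

variable {A : Type*} [CStarAlgebra A] [PartialOrder A] [StarOrderedRing A]
  {U : Type*} [NormedAddCommGroup U] [NormedSpace ℂ U] [Module A U] [CStarModule A U]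

/-- A symmetric map `R` with `0 ≤ ⟨f, R f⟩ ≤ r ⟨f, f⟩` is bounded by `r`. -/
theorem norm_le_of_symmetric_of_inner_le {R : U →ₗ[ℂ] U} {r : ℝ} (hr : 0 ≤ r)
    (symm : ∀ f g : U, inner A (R f) g = inner A f (R g))
    (nonneg : ∀ f : U, 0 ≤ inner A f (R f))
    (le : ∀ f : U, inner A f (R f) ≤ r • inner A f f) (f : U) :
    ‖R f‖ ≤ r * ‖f‖ := by
  rcases eq_or_ne (R f) 0 with h0 | h0
  · rw [h0, norm_zero]
    positivity
  have hf : f ≠ 0 := by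
    rintro rfl
    exact h0 (map_zero R)
  have hf' : 0 < ‖f‖ := norm_pos_iff.2 hf
  have hR' : 0 < ‖R f‖ := norm_pos_iff.2 h0
  -- Polarization with `s • R f` scaled to the norm of `f`, so that `‖f ± s • R f‖ ≤ 2 ‖f‖`.
  set s : ℝ := ‖f‖ / ‖R f‖ with hs
  have hs0 : 0 ≤ s := by positivity
  have hRs : R (s • R f) = s • R (R f) := by simp
  have key : (4 * s) • inner A (R f) (R f) =
      inner A (f + s • R f) (R (f + s • R f)) - inner A (f - s • R f) (R (f - s • R f)) := by
    simp only [map_add, map_sub, hRs, CStarModule.inner_add_right, CStarModule.inner_add_left,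
      CStarModule.inner_sub_right, CStarModule.inner_sub_left, CStarModule.inner_smul_left_real,
      CStarModule.inner_smul_right_real]
    rw [← symm f (R f)]
    module
  have hle : (4 * s) • inner A (R f) (R f) ≤ r • inner A (f + s • R f) (f + s • R f) := by
    rw [key]
    exact (sub_le_self _ (nonneg _)).trans (le _)
  have hnorm := CStarAlgebra.norm_le_norm_of_nonneg_of_le
    (smul_nonneg (by positivity) CStarModule.inner_self_nonneg) hle
  rw [norm_smul, norm_smul, ← CStarModule.norm_sq_eq, ← CStarModule.norm_sq_eq,
    Real.norm_of_nonneg (by positivity)] at hnorm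
  have htri : ‖f + s • R f‖ ≤ 2 * ‖f‖ := by
    refine (norm_add_le _ _).trans ?_
    have : ‖s • R f‖ = ‖f‖ := by
      rw [← Complex.coe_smul, norm_smul, Complex.norm_real, Real.norm_of_nonneg hs0, hs]
      field_simp
    linarith
  rw [Real.norm_of_nonneg hr] at hnorm
  have h3 : 4 * s * ‖R f‖ ^ 2 ≤ r * (2 * ‖f‖) ^ 2 := hnorm.trans (by gcongr)
  have h4 : s * ‖R f‖ ^ 2 = ‖f‖ * ‖R f‖ := by
    rw [hs]
    field_simp
  nlinarith

/-- A symmetric map with `C ⟨f, f⟩ ≤ ⟨f, S f⟩ ≤ B ⟨f, f⟩` has a right inverse. -/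
theorem exists_rightInverse_of_symmetric [CompleteSpace U] {S : U →ₗ[ℂ] U} {C B : ℝ}
    (hC : 0 < C) (hB : 0 < B)
    (symm : ∀ f g : U, inner A (S f) g = inner A f (S g))
    (lower : ∀ f : U, C • inner A f f ≤ inner A f (S f))
    (upper : ∀ f : U, inner A f (S f) ≤ B • inner A f f) :
    ∃ J : U → U, ∀ g, S (J g) = g := by
  -- The form of `R` lies between `0` and `1 - C / B`, so `‖R‖ < 1` and `B⁻¹ S = 1 - R` is
  -- invertible.
  set R : U →ₗ[ℂ] U := LinearMap.id - ((B⁻¹ : ℝ) : ℂ) • S with hR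
  have hRf (f : U) : R f = f - B⁻¹ • S f := by
    simp only [hR, LinearMap.sub_apply, LinearMap.id_apply, LinearMap.smul_apply, Complex.coe_smul]
  have hinner (f : U) : inner A f (R f) = inner A f f - B⁻¹ • inner A f (S f) := by
    rw [hRf, CStarModule.inner_sub_right, CStarModule.inner_smul_right_real]
  have bound := norm_le_of_symmetric_of_inner_le (A := A) (R := R) (r := max (1 - B⁻¹ * C) 0)
    (le_max_right _ _)
    (fun f g => by
      rw [hRf, hRf, CStarModule.inner_sub_right, CStarModule.inner_sub_left,
        CStarModule.inner_smul_right_real, CStarModule.inner_smul_left_real, symm])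
    (fun f => by
      rw [hinner, sub_nonneg]
      calc B⁻¹ • inner A f (S f) ≤ B⁻¹ • B • inner A f f :=
            smul_le_smul_of_nonneg_left (upper f) (by positivity)
        _ = inner A f f := by rw [smul_smul, inv_mul_cancel₀ hB.ne', one_smul])
    (fun f => by
      refine le_trans ?_ (smul_le_smul_of_nonneg_right (le_max_left _ _)
        CStarModule.inner_self_nonneg)
      rw [hinner, sub_smul, one_smul, mul_smul]
      exact sub_le_sub_left (smul_le_smul_of_nonneg_left (lower f) (by positivity)) _)
  have hlt : ‖R.mkContinuous _ bound‖ < 1 := by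
    refine (R.mkContinuous_norm_le' bound).trans_lt (max_lt (max_lt ?_ one_pos) one_pos)
    have : 0 < B⁻¹ * C := by positivity
    linarith
  let V := Units.oneSub (R.mkContinuous _ bound) hlt
  refine ⟨fun g => ((B⁻¹ : ℝ) : ℂ) • (↑V⁻¹ : U →L[ℂ] U) g, fun g => ?_⟩
  have h1 : (V : U →L[ℂ] U) ((↑V⁻¹ : U →L[ℂ] U) g) = g :=
    DFunLike.congr_fun V.mul_inv g
  have h2 (x : U) : (V : U →L[ℂ] U) x = ((B⁻¹ : ℝ) : ℂ) • S x := by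
    simp [V, hR]
  rw [map_smul, ← h2, h1]

/-- A symmetric map with `C ⟨f, f⟩ ≤ ⟨f, S f⟩` satisfies `C² ⟨f, f⟩ ≤ ⟨S f, S f⟩`. -/
theorem sq_smul_inner_self_le_of_symmetric {S : U → U} {C : ℝ} (hC : 0 < C)
    (symm : ∀ f g : U, inner A (S f) g = inner A f (S g))
    (lower : ∀ f : U, C • inner A f f ≤ inner A f (S f)) (f : U) :
    C ^ 2 • inner A f f ≤ inner A (S f) (S f) := by
  -- Expanding this square and adding `2C (⟨f, S f⟩ - C ⟨f, f⟩) ≥ 0` cancels the cross terms.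
  have h : (0 : A) ≤ inner A (S f - C • f) (S f - C • f) := CStarModule.inner_self_nonneg
  have h' : (2 * C) • (C • inner A f f) ≤ (2 * C) • inner A f (S f) :=
    smul_le_smul_of_nonneg_left (lower f) (by positivity)
  simp only [CStarModule.inner_sub_right, CStarModule.inner_sub_left,
    CStarModule.inner_smul_left_real, CStarModule.inner_smul_right_real, symm f f] at h
  rw [← sub_nonneg] at h' ⊢
  convert add_nonneg h h' using 1
  module

end SymmetricMaps

section Frames

set_option linter.unusedSectionVars false

variable {A : Type*} [CStarAlgebra A] [PartialOrder A] [StarOrderedRing A]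
  {U : Type*} [NormedAddCommGroup U] [NormedSpace ℂ U] [Module A U] [CStarModule A U]
  {Ω : Type*} [MeasurableSpace Ω] {μ : Measure Ω} {F : Ω → U}

/-- `S` is synthesis applied to the coefficients of `f`. Taking adjoints under the integral gives
symmetry, and symmetry forces linearity. -/
theorem IsContinuousFrame.exists_frameOperator (hF : IsContinuousFrame A μ F)
    (hT : HasSynthesisOperator A μ F) :
    ∃ S : U →ₗ[ℂ] U, (∀ f g : U, inner A (S f) g = inner A f (S g)) ∧
      ∀ f g : U, inner A g (S f) = ∫ ω, inner A (F ω) f * inner A g (F ω) ∂μ := by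
  have hmem (f : U) : MemLTwo A μ (fun ω => inner A (F ω) f) :=
    ⟨hF.weaklyMeasurable f, by simpa using hF.integrable f⟩
  choose S hS using fun f => hT _ (hmem f)
  have symm (f g : U) : inner A (S f) g = inner A f (S g) := by
    rw [← CStarModule.star_inner, hS, hS, ← integral_star_cstarAlgebra]
    simp
  refine ⟨⟨⟨S, fun f g => ?_⟩, fun c f => ?_⟩, symm, fun f g => hS f g⟩
  · refine cstarModule_ext_inner (A := A) fun h => ?_
    simp only [CStarModule.inner_add_right, ← symm]
  · refine cstarModule_ext_inner (A := A) fun h => ?_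
    simp only [CStarModule.inner_smul_right_complex, ← symm, RingHom.id_apply]

/-- The canonical dual `S⁻¹ F` of a frame `F` with frame operator `S`. -/
theorem IsContinuousFrame.exists_canonicalDual [CompleteSpace U] (hF : IsContinuousFrame A μ F)
    (hT : HasSynthesisOperator A μ F) :
    ∃ S J : U → U, (∀ f, J (S f) = f) ∧ (∀ f g : U, inner A (J f) g = inner A f (J g)) ∧
      IsDualOf A μ (fun ω => J (F ω)) F := by
  obtain ⟨S, symm, hS⟩ := hF.exists_frameOperator hT
  obtain ⟨C, hC, lower⟩ := hF.lower
  obtain ⟨B, hB, upper⟩ := hF.upper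
  have lower' (f : U) : C • inner A f f ≤ inner A f (S f) := by
    rw [hS]
    exact lower f
  obtain ⟨J, hJ⟩ := exists_rightInverse_of_symmetric hC hB symm lower'
    (fun f => by rw [hS]; exact upper f)
  have symmJ (f g : U) : inner A (J f) g = inner A f (J g) := by
    conv_lhs => rw [← hJ g]
    rw [← symm, hJ]
  have hJS (f : U) : J (S f) = f :=
    cstarModule_ext_inner (A := A) fun g => by rw [← symmJ, ← symm, hJ]
  have hJF (f : U) (ω : Ω) : inner A (J (F ω)) f = inner A (F ω) (J f) := symmJ _ _
  have hFJ (f : U) (ω : Ω) : inner A f (J (F ω)) = inner A (J f) (F ω) := (symmJ _ _).symm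
  refine ⟨S, J, hJS, symmJ, ⟨fun f => ?_, fun f => ?_, B * (C ^ 2)⁻¹, by positivity, fun f => ?_⟩,
    fun f g => ?_⟩
  · simp only [hJF]
    exact hF.weaklyMeasurable (J f)
  · simp only [hJF, hFJ]
    exact hF.integrable (J f)
  · simp only [hJF, hFJ]
    refine (upper (J f)).trans ?_
    rw [mul_smul]
    refine smul_le_smul_of_nonneg_left ?_ hB.le
    -- With `S J f = f`, this gives `⟨J f, J f⟩ ≤ C⁻² ⟨f, f⟩`, whence the Bessel bound `B C⁻²`.
    have h := smul_le_smul_of_nonneg_left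
      (sq_smul_inner_self_le_of_symmetric hC symm lower' (J f)) (inv_nonneg.2 (sq_nonneg C))
    rwa [hJ, smul_smul, inv_mul_cancel₀ (by positivity), one_smul] at h
  · simp only [hJF]
    rw [← hS, hJ]

/-- Extend coefficients by zero outside `s`. -/
theorem HasSynthesisOperator.restrict (hT : HasSynthesisOperator A μ F) {s : Set Ω}
    (hs : MeasurableSet s) : HasSynthesisOperator A (μ.restrict s) F := by
  rintro φ ⟨hφ, hφi⟩
  obtain ⟨u, hu⟩ := hT (s.indicator φ) ⟨(aestronglyMeasurable_indicator_iff hs).2 hφ, by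
    refine ((integrable_indicator_iff hs).2 hφi).congr (.of_forall fun ω => ?_)
    by_cases h : ω ∈ s <;> simp [h]⟩
  refine ⟨u, fun f => ?_⟩
  rw [hu, ← integral_indicator hs]
  congr 1 with ω
  by_cases h : ω ∈ s <;> simp [h]

open scoped Classical in
/-- A Bessel mapping off `s`, extended by a constant to a set `s` of finite measure. -/
theorem IsBesselMapping.piecewise_const {G : Ω → U} {s : Set Ω} (hs : MeasurableSet s)
    (hμs : μ s < ⊤) (hG : IsBesselMapping A (μ.restrict sᶜ) G) (u : U) :
    IsBesselMapping A μ (s.piecewise (fun _ => u) G) := by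
  have hrw (f : U) : (fun ω => inner A (s.piecewise (fun _ => u) G ω) f *
      inner A f (s.piecewise (fun _ => u) G ω)) =
      s.piecewise (fun _ => inner A u f * inner A f u)
        (fun ω => inner A (G ω) f * inner A f (G ω)) := by
    ext ω
    by_cases h : ω ∈ s <;> simp [h]
  have hconst (f : U) : IntegrableOn (fun _ : Ω => inner A u f * inner A f u) s μ :=
    integrableOn_const hμs.ne
  obtain ⟨B, hB, upper⟩ := hG.upper
  refine ⟨fun f => ?_, fun f => ?_, μ.real s * ‖u‖ ^ 2 + B, by positivity, fun f => ?_⟩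
  · have : (fun ω => inner A (s.piecewise (fun _ => u) G ω) f) =
        s.piecewise (fun _ => inner A u f) (fun ω => inner A (G ω) f) := by
      ext ω
      by_cases h : ω ∈ s <;> simp [h]
    rw [this]
    exact AEStronglyMeasurable.piecewise hs aestronglyMeasurable_const (hG.weaklyMeasurable f)
  · rw [hrw]
    exact Integrable.piecewise hs (hconst f) (hG.integrable f)
  · rw [hrw, integral_piecewise hs (hconst f) (hG.integrable f), add_smul, setIntegral_const,
      mul_smul]
    refine add_le_add (smul_le_smul_of_nonneg_left ?_ measureReal_nonneg) (upper f)
    exact CStarModule.inner_mul_inner_swap_le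

open scoped Classical in
/-- A dual off `s` extends by any constant to `s`, if `F` vanishes weakly on `s` or the constant
is zero. -/
theorem IsDualOf.piecewise_const {G : Ω → U} {s : Set Ω} (hs : MeasurableSet s)
    (hμs : μ s < ⊤) (hG : IsDualOf A (μ.restrict sᶜ) G F) (u : U)
    (hu : ∀ f g : U, ∀ᵐ ω ∂μ, ω ∈ s → inner A u f * inner A g (F ω) = 0) :
    IsDualOf A μ (s.piecewise (fun _ => u) G) F := by
  refine ⟨hG.1.piecewise_const hs hμs u, fun f g => ?_⟩
  rw [hG.2, ← integral_indicator hs.compl]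
  refine integral_congr_ae ?_
  filter_upwards [hu f g] with ω hω
  by_cases h : ω ∈ s
  · simp [h, hω h]
  · simp [h]

end Frames

theorem mainTheorem7
    {A : Type*} [CStarAlgebra A] [PartialOrder A] [StarOrderedRing A]
    {U : Type*} [NormedAddCommGroup U] [NormedSpace ℂ U] [Module A U] [CStarModule A U]
    [CompleteSpace U] [Nontrivial U]
    {Ω : Type*} [MeasurableSpace Ω] (μ : MeasureTheory.Measure Ω)
    (F : Ω → U) (hT : HasSynthesisOperator A μ F) (hF : IsRieszTypeFrame A μ F) :
    IsExactContinuousFrame A μ F := by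
  classical
  obtain ⟨hframe, -, huniq⟩ := hF
  refine ⟨hframe, fun s hs hpos hfin hrestr => ?_⟩
  obtain ⟨S, J, hJS, symmJ, hdual⟩ := hframe.exists_canonicalDual hT
  obtain ⟨-, K, -, -, hdual'⟩ := hrestr.exists_canonicalDual (hT.restrict hs.compl)
  have hzero := hdual'.piecewise_const hs hfin 0 (by simp)
  have hvanish (f : U) : ∀ᵐ ω ∂μ, ω ∈ s → inner A f (F ω) = 0 := by
    -- Testing against `S f` undoes `J` and leaves `⟨f, F ω⟩`.
    filter_upwards [huniq _ _ hdual hzero (S f)] with ω hω hωs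
    rw [symmJ, hJS, Set.piecewise_eq_of_mem _ _ _ hωs, CStarModule.inner_zero_left] at hω
    rw [← CStarModule.star_inner, hω, star_zero]
  obtain ⟨u, hu⟩ := exists_ne (0 : U)
  have hconst := hdual'.piecewise_const hs hfin u fun f g => by
    filter_upwards [hvanish g] with ω hω hωs
    rw [hω hωs, mul_zero]
  -- Tested against `u` itself, the two duals differ at every point of `s`, since `⟨u, u⟩ ≠ 0`.
  refine hpos.ne' (measure_mono_null (fun ω hωs => ?_) (ae_iff.1 (huniq _ _ hconst hzero u)))
  simpa [hωs, CStarModule.inner_self] using hu
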